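/- Let $\kappa>1$. Let $\mathrm{Ein}(z)=\int_0^z \frac{1-e^{-t}}{t}\,dt$ (an entire function), and for $c>0$ and $v\in\mathbb R$ put $$\lambda_\kappa(v)=\frac1{2\pi i}\int_{c-i\infty}^{c+i\infty}e^{vz}z^{-2\kappa}e^{\kappa\,\mathrm{Ein}(z)}\,dz,$$ with the principal branch of the power. Then this integral converges absolutely, is real, and does not depend on $c>0$. The function $\lambda_\kappa:\mathbb R\to\mathbb R$ is continuous, vanishes for $v\le 0$, and satisfies the delay differential equation $$\bigl(v^{1-\kappa}\lambda_\kappa(v)\bigr)'=\kappa v^{-\kappa}\lambda_\kappa(v-1)\quad(v>0)$$ with the boundary condition $$\lambda_\kappa(v)=\frac{e^{\kappa\gamma}}{\Gamma(\kappa)}v^{\kappa-1}\quad(0\le v\le1),$$ where $\gamma$ is Euler's constant. Moreover $\lambda_\kappa(v)\ge 0$ for all $v$, and $$\int_0^\infty e^{-vt}\lambda_\kappa(v)\,dv=t^{-2\kappa}e^{\kappa\,\mathrm{Ein}(t)}\quad(t>0).$$ Let further $u>0$ and $f(t)=t^{-2\kappa}e^{-ut}e^{\kappa\,\mathrm{Ein}(t)}$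 for $t>0$. Then $f$ is infinitely differentiable on $(0,\infty)$, and for all $t>0$ $$f^{(4)}(t)=\int_0^\infty(u+v)^4e^{-(u+v)t}\lambda_\kappa(v)\,dv,\qquad f^{(5)}(t)=-\int_0^\infty(u+v)^5e^{-(u+v)t}\lambda_\kappa(v)\,dv,$$ all the integrals over $(0,\infty)$ being absolutely convergent. Consequently $f^{(4)}$ is nonnegative and nonincreasing on $(0,\infty)$, and for all $0<a<b$ $$\sup_{a\le t\le b}\bigl|f^{(4)}(t)\bigr|=f^{(4)}(a).$$ -/

import Mathlib

noncomputable section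

/-- The complementary exponential integral `Ein x = ∫_0^x (1 - e^{-t}) / t dt` of a real number.
(The value of the integrand at the single point `t = 0` does not affect the integral.) -/
def realEin (x : ℝ) : ℝ :=
  ∫ t in (0 : ℝ)..x, (1 - Real.exp (-t)) / t

/-- The entire function `Ein z = ∫_0^z (1 - e^{-ζ}) / ζ dζ`, integrated along the segment
`ζ = s z`, `0 ≤ s ≤ 1`, from `0` to `z`. -/
def complexEin (z : ℂ) : ℂ :=
  ∫ s in (0 : ℝ)..1, (1 - Complex.exp (-((s : ℂ) * z))) / ((s : ℂ) * z) * z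

/-- On the real line the two definitions of `Ein` agree. -/
theorem complexEin_ofReal (x : ℝ) : complexEin (x : ℂ) = (realEin x : ℂ) := by
  have h : ∀ s : ℝ, (1 - Complex.exp (-((s : ℂ) * (x : ℂ)))) / ((s : ℂ) * (x : ℂ)) * (x : ℂ)
      = (((1 - Real.exp (-(s * x))) / (s * x) * x : ℝ) : ℂ) := by
    intro s; push_cast; rfl
  unfold complexEin realEin
  simp_rw [h]
  rw [intervalIntegral.integral_ofReal, intervalIntegral.integral_mul_const, mul_comm,
    ← smul_eq_mul, intervalIntegral.smul_integral_comp_mul_right (fun t : ℝ => (1 - Real.exp (-t)) / t) x, zero_mul, one_mul]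

/-- The function `e^{vz} z^{-2κ} e^{κ Ein z}` (principal branch of the power). -/
def inversionIntegrand (κ v : ℝ) (z : ℂ) : ℂ :=
  Complex.exp ((v : ℂ) * z) * z ^ (-2 * (κ : ℂ)) * Complex.exp ((κ : ℂ) * complexEin z)

/-- The point `c + i y` of the vertical line of abscissa `c`. -/
def verticalPoint (c y : ℝ) : ℂ := (c : ℂ) + (y : ℂ) * Complex.I

/-- The line integral `(1 / (2πi)) ∫_{c - i∞}^{c + i∞} e^{vz} z^{-2κ} e^{κ Ein z} dz`,
with the parametrization `z = c + i y`, `dz = i dy`. -/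
def inversionIntegral (κ c v : ℝ) : ℂ :=
  1 / (2 * (Real.pi : ℂ) * Complex.I) *
    ∫ y : ℝ, inversionIntegrand κ v (verticalPoint c y) * Complex.I

/-- The function `λ_κ`, as a real-valued function, computed on the line of abscissa `1`.  That the
line integral is real and does not depend on the abscissa is not part of the definition. -/
def sieveLambda (κ v : ℝ) : ℝ := (inversionIntegral κ 1 v).re

/-- The integrand `f(t) = t^{-2κ} e^{-ut} e^{κ Ein t}`. -/
def sieveIntegrand (κ u t : ℝ) : ℝ :=
  t ^ (-2 * κ) * Real.exp (-u * t) * Real.exp (κ * realEin t)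

end

open MeasureTheory Set Filter Topology ProbabilityTheory

noncomputable section

/-! The contour integral is never analysed directly. The candidate for `λ_κ` is built from the delay
equation: with `q(v) = v^{1-κ} λ(v)` it reads `q'(v) = k(v) q(v-1)`, where `k = stepKernel κ`
vanishes up to `1`, so it is solved by steps from `q = A` on `v ≤ 1`. Positivity and the bound `q ≤
A max(v,1)^κ` are visible in the iteration, so the Laplace transform `L` of `v^{κ-1} q(v)` exists
for `Re z > 0`.

The delay equation turns into `z L'(z) = -κ (1 + e^{-z}) L(z)`. Since `Ein' = (1 - e^{-z})/z`, the
function `z^{-2κ} e^{κ Ein z}` solves the same equation, and `L` is a constant multiple of it. As `t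
→ ∞` one has `t^κ L(t) → A Γ(κ)`, while `Ein = log + γ + E₁` with `E₁(t) → 0`; the choice `A =
e^{κγ}/Γ(κ)` makes the constant `1` (`laplace_delayLambda`).

The same formula for `Ein` gives `|L(z)| ≪ |z|^{-κ}` on vertical lines. As `κ > 1`, Fourier
inversion applies and identifies the contour integral with the candidate (`inversionIntegral_eq`).
Finally `f(t) = e^{-ut} L(t)` is a moment generating function, which may be differentiated under the
integral (`iteratedDeriv_sieveIntegrand`). -/

/-! ### The delay equation solved by steps -/

/-- The kernel `κ w^{-κ} (w - 1)^{κ - 1}` for `w ≥ 1`, continued by `0`. -/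
def stepKernel (κ w : ℝ) : ℝ := κ * max w 1 ^ (-κ) * max (w - 1) 0 ^ (κ - 1)

/-- The clamp `max w 1` keeps the negative power away from `0`, and `κ - 1 > 0` makes the other
factor reach `0` continuously at `w = 1`. -/
theorem continuous_stepKernel {κ : ℝ} (hκ : 1 < κ) : Continuous (stepKernel κ) := by
  unfold stepKernel
  refine (continuous_const.mul ?_).mul ?_
  · exact (continuous_id.max continuous_const).rpow_const
      fun w => Or.inl (lt_of_lt_of_le one_pos (le_max_right w 1)).ne'
  · exact ((continuous_id.sub continuous_const).max continuous_const).rpow_const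
      fun w => Or.inr (by linarith)

theorem stepKernel_nonneg {κ : ℝ} (hκ : 1 < κ) (w : ℝ) : 0 ≤ stepKernel κ w := by
  unfold stepKernel
  have : 0 ≤ max w 1 := le_max_of_le_right zero_le_one
  positivity

theorem stepKernel_eq_zero {κ : ℝ} (hκ : 1 < κ) {w : ℝ} (hw : w ≤ 1) : stepKernel κ w = 0 := by
  unfold stepKernel
  rw [max_eq_right (by linarith : w - 1 ≤ 0), Real.zero_rpow (by linarith), mul_zero]

theorem stepKernel_le {κ : ℝ} (hκ : 1 < κ) {w : ℝ} (hw : 1 ≤ w) : stepKernel κ w ≤ κ * w⁻¹ := by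
  unfold stepKernel
  have h0 : 0 < w := by linarith
  rw [max_eq_left hw, max_eq_left (by linarith : 0 ≤ w - 1), mul_assoc]
  refine mul_le_mul_of_nonneg_left ?_ (by linarith)
  calc w ^ (-κ) * (w - 1) ^ (κ - 1) ≤ w ^ (-κ) * w ^ (κ - 1) := by
        gcongr
        · linarith
    _ = w⁻¹ := by
        rw [← Real.rpow_add h0, ← Real.rpow_neg_one]; congr 1; ring

/-- Iterates of the integrated delay equation for `v^{1-κ} λ_κ(v)`. -/
def stepIter (κ A : ℝ) : ℕ → ℝ → ℝ
  | 0 => fun _ => A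
  | n + 1 => fun v => A + ∫ w in (1 : ℝ)..v, stepKernel κ w * stepIter κ A n (w - 1)

theorem stepIter_succ (κ A : ℝ) (n : ℕ) (v : ℝ) : stepIter κ A (n + 1) v
    = A + ∫ w in (1 : ℝ)..v, stepKernel κ w * stepIter κ A n (w - 1) := rfl

theorem continuous_stepIter {κ : ℝ} (hκ : 1 < κ) (A : ℝ) (n : ℕ) :
    Continuous (stepIter κ A n) := by
  induction n with
  | zero => exact continuous_const
  | succ n ih =>
    refine continuous_const.add (intervalIntegral.continuous_primitive (fun a b => ?_) 1)
    exact ((continuous_stepKernel hκ).mul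
      (ih.comp (continuous_id.sub continuous_const))).intervalIntegrable a b

theorem integral_stepKernel_mul_of_le {κ : ℝ} (hκ : 1 < κ) (f : ℝ → ℝ) {v : ℝ} (hv : v ≤ 1) :
    ∫ w in (1 : ℝ)..v, stepKernel κ w * f (w - 1) = 0 := by
  rw [intervalIntegral.integral_congr (g := fun _ => 0), intervalIntegral.integral_zero]
  intro w hw
  rw [uIcc_of_ge hv] at hw
  simp [stepKernel_eq_zero hκ hw.2]

/-- The delay is `1`, so values up to `n + 2` only use the previous iterate up to `n + 1`: each
iteration fixes one more unit interval. -/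
theorem stepIter_succ_eq {κ : ℝ} (hκ : 1 < κ) (A : ℝ) (n : ℕ) {v : ℝ} (hv : v ≤ n + 1) :
    stepIter κ A (n + 1) v = stepIter κ A n v := by
  induction n generalizing v with
  | zero =>
    simp only [stepIter]
    rw [integral_stepKernel_mul_of_le hκ (fun _ => A) (by simpa using hv), add_zero]
  | succ n ih =>
    rcases le_total v 1 with h1 | h1
    · rw [stepIter_succ, integral_stepKernel_mul_of_le hκ _ h1, stepIter_succ,
        integral_stepKernel_mul_of_le hκ _ h1]
    · rw [stepIter_succ κ A (n + 1), stepIter_succ κ A n]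
      congr 1
      refine intervalIntegral.integral_congr fun w hw => ?_
      rw [uIcc_of_le h1] at hw
      push_cast at hv
      rw [ih (by linarith [hw.2])]

theorem stepIter_eq_of_le {κ : ℝ} (hκ : 1 < κ) (A : ℝ) {n m : ℕ} (hnm : n ≤ m) {v : ℝ}
    (hv : v ≤ n + 1) : stepIter κ A m v = stepIter κ A n v := by
  induction m, hnm using Nat.le_induction with
  | base => rfl
  | succ m hm ih =>
    rw [stepIter_succ_eq hκ A m (hv.trans (by gcongr)), ih]

/-- The solution of the integrated delay equation for `v^{1-κ} λ_κ(v)`. -/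
def delaySolution (κ A v : ℝ) : ℝ := stepIter κ A ⌈v⌉₊ v

/-- Any late enough iterate may stand in for the solution, so continuity and the integral equation
are inherited locally from the iterates. -/
theorem delaySolution_eq_stepIter {κ : ℝ} (hκ : 1 < κ) (A : ℝ) {n : ℕ} {v : ℝ}
    (hv : v ≤ n + 1) : delaySolution κ A v = stepIter κ A n v := by
  have h1 : v ≤ (⌈v⌉₊ : ℝ) + 1 := (Nat.le_ceil v).trans (by linarith)
  rw [delaySolution, ← stepIter_eq_of_le hκ A (le_max_left ⌈v⌉₊ n) h1,
    stepIter_eq_of_le hκ A (le_max_right ⌈v⌉₊ n) hv]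

theorem continuous_delaySolution {κ : ℝ} (hκ : 1 < κ) (A : ℝ) :
    Continuous (delaySolution κ A) := by
  rw [continuous_iff_continuousAt]
  intro v
  refine (continuous_stepIter hκ A ⌈v⌉₊).continuousAt.congr ?_
  have : v < (⌈v⌉₊ : ℝ) + 1 := by linarith [Nat.le_ceil v]
  filter_upwards [Iio_mem_nhds this] with w hw
  exact (delaySolution_eq_stepIter hκ A (le_of_lt hw)).symm

theorem delaySolution_of_le_one {κ : ℝ} (hκ : 1 < κ) (A : ℝ) {v : ℝ} (hv : v ≤ 1) :
    delaySolution κ A v = A := by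
  rw [delaySolution_eq_stepIter hκ A (n := 0) (by simpa using hv), stepIter]

theorem delaySolution_eq_integral {κ : ℝ} (hκ : 1 < κ) (A v : ℝ) :
    delaySolution κ A v
      = A + ∫ w in (1 : ℝ)..v, stepKernel κ w * delaySolution κ A (w - 1) := by
  rcases le_total v 1 with h1 | h1
  · rw [delaySolution_of_le_one hκ A h1, integral_stepKernel_mul_of_le hκ _ h1, add_zero]
  · have hc := Nat.le_ceil v
    rw [delaySolution_eq_stepIter hκ A (n := ⌈v⌉₊ + 1) (by push_cast; linarith), stepIter_succ]
    congr 1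
    refine intervalIntegral.integral_congr fun w hw => ?_
    rw [uIcc_of_le h1] at hw
    rw [delaySolution_eq_stepIter hκ A (n := ⌈v⌉₊) (by linarith [hw.2])]

theorem hasDerivAt_delaySolution {κ : ℝ} (hκ : 1 < κ) (A v : ℝ) :
    HasDerivAt (delaySolution κ A) (stepKernel κ v * delaySolution κ A (v - 1)) v := by
  have hc : Continuous fun w => stepKernel κ w * delaySolution κ A (w - 1) :=
    (continuous_stepKernel hκ).mul
      ((continuous_delaySolution hκ A).comp (continuous_id.sub continuous_const))
  exact ((hc.integral_hasStrictDerivAt 1 v).hasDerivAt.const_add A).congr_of_eventuallyEq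
    (Eventually.of_forall (delaySolution_eq_integral hκ A))

theorem le_stepIter {κ : ℝ} (hκ : 1 < κ) {A : ℝ} (hA : 0 ≤ A) (n : ℕ) (v : ℝ) :
    A ≤ stepIter κ A n v := by
  induction n generalizing v with
  | zero => exact le_rfl
  | succ n ih =>
    rw [stepIter_succ, le_add_iff_nonneg_right]
    rcases le_total v 1 with h1 | h1
    · rw [integral_stepKernel_mul_of_le hκ _ h1]
    · exact intervalIntegral.integral_nonneg h1 fun w _ =>
        mul_nonneg (stepKernel_nonneg hκ w) (hA.trans (ih _))

/-- The bound reproduces itself: the kernel is at most `κ / w`, and `A + ∫_1^v A κ w^{κ-1} dw = A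
v^κ`. -/
theorem stepIter_le {κ : ℝ} (hκ : 1 < κ) {A : ℝ} (hA : 0 ≤ A) (n : ℕ) (v : ℝ) :
    stepIter κ A n v ≤ A * max v 1 ^ κ := by
  induction n generalizing v with
  | zero =>
    exact le_mul_of_one_le_right hA (Real.one_le_rpow (le_max_right v 1) (by linarith))
  | succ n ih =>
    rw [stepIter_succ]
    rcases le_total v 1 with h1 | h1
    · rw [integral_stepKernel_mul_of_le hκ _ h1, add_zero, max_eq_right h1, Real.one_rpow, mul_one]
    · rw [max_eq_left h1]
      have hb : ∫ w in (1 : ℝ)..v, stepKernel κ w * stepIter κ A n (w - 1)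
          ≤ ∫ w in (1 : ℝ)..v, A * κ * w ^ (κ - 1) := by
        refine intervalIntegral.integral_mono_on h1
          (((continuous_stepKernel hκ).mul ((continuous_stepIter hκ A n).comp
            (continuous_id.sub continuous_const))).intervalIntegrable _ _)
          ((intervalIntegral.intervalIntegrable_rpow' (by linarith)).const_mul _) fun w hw => ?_
        have hw0 : 0 < w := by linarith [hw.1]
        calc stepKernel κ w * stepIter κ A n (w - 1)
            ≤ (κ * w⁻¹) * (A * max (w - 1) 1 ^ κ) := by
              gcongr
              · exact hA.trans (le_stepIter hκ hA n _)
              · exact stepKernel_le hκ hw.1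
              · exact ih _
          _ ≤ (κ * w⁻¹) * (A * w ^ κ) := by
              gcongr
              · exact max_le (by linarith) hw.1
          _ = A * κ * w ^ (κ - 1) := by
              rw [Real.rpow_sub_one hw0.ne']; field_simp
      rw [intervalIntegral.integral_const_mul, integral_rpow (Or.inl (by linarith))] at hb
      simp only [sub_add_cancel, Real.one_rpow] at hb
      have : A * κ * ((v ^ κ - 1) / κ) = A * v ^ κ - A := by
        field_simp
      linarith

theorem le_delaySolution {κ : ℝ} (hκ : 1 < κ) {A : ℝ} (hA : 0 ≤ A) (v : ℝ) :
    A ≤ delaySolution κ A v := le_stepIter hκ hA _ v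

theorem delaySolution_le {κ : ℝ} (hκ : 1 < κ) {A : ℝ} (hA : 0 ≤ A) (v : ℝ) :
    delaySolution κ A v ≤ A * max v 1 ^ κ := stepIter_le hκ hA _ v

/-! ### The candidate for `λ_κ` -/

/-- The solution of the delay differential equation for `λ_κ` equal to `A v^{κ-1}` on `[0, 1]`. -/
def delayLambda (κ A v : ℝ) : ℝ := max v 0 ^ (κ - 1) * delaySolution κ A v

theorem continuous_delayLambda {κ : ℝ} (hκ : 1 < κ) (A : ℝ) : Continuous (delayLambda κ A) :=
  ((continuous_id.max continuous_const).rpow_const fun _ => Or.inr (by linarith)).mul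
    (continuous_delaySolution hκ A)

theorem delayLambda_of_nonpos {κ : ℝ} (hκ : 1 < κ) (A : ℝ) {v : ℝ} (hv : v ≤ 0) :
    delayLambda κ A v = 0 := by
  rw [delayLambda, max_eq_right hv, Real.zero_rpow (by linarith), zero_mul]

theorem delayLambda_of_le_one {κ : ℝ} (hκ : 1 < κ) (A : ℝ) {v : ℝ} (h0 : 0 ≤ v) (h1 : v ≤ 1) :
    delayLambda κ A v = A * v ^ (κ - 1) := by
  rw [delayLambda, max_eq_left h0, delaySolution_of_le_one hκ A h1, mul_comm]

theorem delayLambda_nonneg {κ : ℝ} (hκ : 1 < κ) {A : ℝ} (hA : 0 ≤ A) (v : ℝ) :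
    0 ≤ delayLambda κ A v :=
  mul_nonneg (Real.rpow_nonneg (le_max_right v 0) _) (hA.trans (le_delaySolution hκ hA v))

theorem delayLambda_le {κ : ℝ} (hκ : 1 < κ) {A : ℝ} (hA : 0 ≤ A) {v : ℝ} (hv : 0 < v) :
    delayLambda κ A v ≤ A * (v ^ (κ - 1) + v ^ (2 * κ - 1)) := by
  have h1 : delaySolution κ A v ≤ A * (1 + v ^ κ) := by
    refine (delaySolution_le hκ hA v).trans (mul_le_mul_of_nonneg_left ?_ hA)
    rcases le_total v 1 with h | h
    · rw [max_eq_right h, Real.one_rpow]; linarith [Real.rpow_nonneg hv.le κ]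
    · rw [max_eq_left h]; linarith
  rw [delayLambda, max_eq_left hv.le]
  calc v ^ (κ - 1) * delaySolution κ A v ≤ v ^ (κ - 1) * (A * (1 + v ^ κ)) := by gcongr
    _ = A * (v ^ (κ - 1) + v ^ (2 * κ - 1)) := by
      rw [show 2 * κ - 1 = (κ - 1) + κ by ring, Real.rpow_add hv]; ring

theorem rpow_mul_delayLambda {κ : ℝ} (A : ℝ) {v : ℝ} (hv : 0 < v) :
    v ^ (1 - κ) * delayLambda κ A v = delaySolution κ A v := by
  rw [delayLambda, max_eq_left hv.le, ← mul_assoc, ← Real.rpow_add hv]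
  simp

theorem stepKernel_mul_delaySolution {κ : ℝ} (hκ : 1 < κ) (A v : ℝ) :
    stepKernel κ v * delaySolution κ A (v - 1) = κ * v ^ (-κ) * delayLambda κ A (v - 1) := by
  rcases le_total v 1 with h | h
  · rw [stepKernel_eq_zero hκ h, delayLambda_of_nonpos hκ A (by linarith)]; simp
  · rw [stepKernel, delayLambda, max_eq_left h]; ring

theorem hasDerivAt_rpow_mul_delayLambda {κ : ℝ} (hκ : 1 < κ) (A : ℝ) {v : ℝ} (hv : 0 < v) :
    HasDerivAt (fun w : ℝ => w ^ (1 - κ) * delayLambda κ A w)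
      (κ * v ^ (-κ) * delayLambda κ A (v - 1)) v := by
  rw [← stepKernel_mul_delaySolution hκ A v]
  refine (hasDerivAt_delaySolution hκ A v).congr_of_eventuallyEq ?_
  filter_upwards [Ioi_mem_nhds hv] with w hw using rpow_mul_delayLambda A hw

/-- This form of the delay equation is linear in `v`, hence suited to the Laplace transform, where
multiplication by `v` becomes `-d/dz`. -/
theorem hasDerivAt_mul_delayLambda {κ : ℝ} (hκ : 1 < κ) (A : ℝ) {v : ℝ} (hv : 0 < v) :
    HasDerivAt (fun w : ℝ => w * delayLambda κ A w)
      (κ * (delayLambda κ A v + delayLambda κ A (v - 1))) v := by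
  have h := (Real.hasDerivAt_rpow_const (p := κ) (Or.inl hv.ne')).mul
    (hasDerivAt_delaySolution hκ A v)
  rw [stepKernel_mul_delaySolution hκ A v] at h
  refine (h.congr_deriv ?_).congr_of_eventuallyEq ?_
  · have h1 : v ^ κ * v ^ (-κ) = 1 := by rw [← Real.rpow_add hv]; simp
    rw [delayLambda.eq_1 κ A v, max_eq_left hv.le]
    linear_combination κ * delayLambda κ A (v - 1) * h1
  · filter_upwards [Ioi_mem_nhds hv] with w hw
    have hw' : 0 < w := hw
    simp only [Pi.mul_apply]
    rw [delayLambda, max_eq_left hw'.le, Real.rpow_sub_one hw'.ne']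
    field_simp

/-! ### Laplace transforms of nonnegative densities as moment generating functions -/

/-- The measure on `(0, ∞)` with density `g`. -/
def densityMeasure (g : ℝ → ℝ) : Measure ℝ :=
  (volume.restrict (Ioi 0)).withDensity fun v => ((g v).toNNReal : ENNReal)

theorem integral_densityMeasure {E : Type*} [NormedAddCommGroup E] [NormedSpace ℝ E]
    {g : ℝ → ℝ} (hm : Measurable g) (h0 : ∀ v, 0 ≤ g v) (f : ℝ → E) :
    ∫ v, f v ∂densityMeasure g = ∫ v in Ioi 0, g v • f v := by
  rw [densityMeasure, integral_withDensity_eq_integral_smul hm.real_toNNReal]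
  refine integral_congr_ae (Eventually.of_forall fun v => ?_)
  simp only [NNReal.smul_def, Real.coe_toNNReal _ (h0 v)]

theorem integrable_densityMeasure_iff {E : Type*} [NormedAddCommGroup E] [NormedSpace ℝ E]
    {g : ℝ → ℝ} (hm : Measurable g) (h0 : ∀ v, 0 ≤ g v) (f : ℝ → E) :
    Integrable f (densityMeasure g) ↔ IntegrableOn (fun v => g v • f v) (Ioi 0) := by
  rw [densityMeasure, integrable_withDensity_iff_integrable_smul hm.real_toNNReal, IntegrableOn]
  refine integrable_congr (Eventually.of_forall fun v => ?_)
  simp only [NNReal.smul_def, Real.coe_toNNReal _ (h0 v)]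

/-- A nonnegative measurable density whose Laplace transform converges on the right half-plane. -/
structure IsLaplaceDensity (g : ℝ → ℝ) : Prop where
  measurable : Measurable g
  nonneg : ∀ v, 0 ≤ g v
  integrableOn : ∀ t : ℝ, 0 < t → IntegrableOn (fun v => Real.exp (-(v * t)) * g v) (Ioi 0)

/-- The Laplace transform of a function on `(0, ∞)`. -/
def laplace (g : ℝ → ℝ) (z : ℂ) : ℂ := ∫ v in Ioi (0 : ℝ), Complex.exp (-(v * z)) * g v

/-- The Laplace transform of a function on `(0, ∞)` at a real point. -/
def realLaplace (g : ℝ → ℝ) (t : ℝ) : ℝ := ∫ v in Ioi (0 : ℝ), Real.exp (-(v * t)) * g v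

theorem laplace_ofReal (g : ℝ → ℝ) (t : ℝ) : laplace g t = realLaplace g t := by
  rw [laplace, realLaplace, ← integral_complex_ofReal]
  congr 1 with v
  push_cast
  rfl

namespace IsLaplaceDensity

variable {g : ℝ → ℝ}

/-- Interior points of the exponential set are where a moment generating function is analytic and
may be differentiated under the integral. The variable is `-(u + v)`, whence the signs `(-1)^n`
below. -/
theorem mem_interior (hg : IsLaplaceDensity g) {u t : ℝ} (ht : 0 < t) :
    t ∈ interior (integrableExpSet (fun v => -(u + v)) (densityMeasure g)) := by
  refine interior_maximal (fun s (hs : 0 < s) => ?_) isOpen_Ioi (show t ∈ Ioi 0 from ht)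
  change Integrable _ _
  rw [integrable_densityMeasure_iff hg.measurable hg.nonneg]
  refine ((hg.integrableOn s hs).const_mul (Real.exp (-(u * s)))).congr
    (Eventually.of_forall fun v => ?_)
  simp only [smul_eq_mul]
  rw [← mul_assoc, ← Real.exp_add, mul_comm (g v)]
  ring_nf

theorem integrableOn_pow (hg : IsLaplaceDensity g) (u : ℝ) {t : ℝ} (ht : 0 < t) (n : ℕ) :
    IntegrableOn (fun v => (u + v) ^ n * Real.exp (-(u + v) * t) * g v) (Ioi 0) := by
  have h := integrable_pow_mul_exp_of_mem_interior_integrableExpSet (hg.mem_interior (u := u) ht) n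
  rw [integrable_densityMeasure_iff hg.measurable hg.nonneg] at h
  refine (h.const_mul ((-1) ^ n)).congr (Eventually.of_forall fun v => ?_)
  simp only [smul_eq_mul]
  rw [neg_pow (u + v) n, mul_comm t]
  have : ((-1 : ℝ) ^ n) * (-1) ^ n = 1 := by rw [← mul_pow]; simp
  linear_combination (g v * (u + v) ^ n * Real.exp (-(u + v) * t)) * this

theorem mgf_eq (hg : IsLaplaceDensity g) (u t : ℝ) :
    mgf (fun v => -(u + v)) (densityMeasure g) t = Real.exp (-u * t) * realLaplace g t := by
  rw [mgf, integral_densityMeasure hg.measurable hg.nonneg, realLaplace, ← integral_const_mul]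
  congr 1 with v
  rw [smul_eq_mul, ← mul_assoc, ← Real.exp_add, mul_comm (g v)]
  ring_nf

theorem iteratedDeriv_mgf_eq (hg : IsLaplaceDensity g) (u : ℝ) {t : ℝ} (ht : 0 < t) (n : ℕ) :
    iteratedDeriv n (mgf (fun v => -(u + v)) (densityMeasure g)) t
      = (-1) ^ n * ∫ v in Ioi 0, (u + v) ^ n * Real.exp (-(u + v) * t) * g v := by
  rw [iteratedDeriv_mgf (hg.mem_interior ht), integral_densityMeasure hg.measurable hg.nonneg,
    ← integral_const_mul]
  congr 1 with v
  rw [smul_eq_mul, neg_pow (u + v) n, mul_comm t]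
  ring

theorem integrableOn_complex (hg : IsLaplaceDensity g) {z : ℂ} (hz : 0 < z.re) :
    IntegrableOn (fun v : ℝ => Complex.exp (-(v * z)) * g v) (Ioi 0) := by
  refine (hg.integrableOn z.re hz).mono' ?_ (Eventually.of_forall fun v => ?_)
  · have := hg.measurable
    exact Measurable.aestronglyMeasurable (by fun_prop)
  · rw [norm_mul, Complex.norm_exp, Complex.norm_real, Real.norm_of_nonneg (hg.nonneg v)]
    simp

theorem hasDerivAt_laplace (hg : IsLaplaceDensity g) {z : ℂ} (hz : 0 < z.re) :
    HasDerivAt (laplace g)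
      (-∫ v in Ioi (0 : ℝ), Complex.exp (-(v * z)) * ((v * g v : ℝ) : ℂ)) z := by
  have h := hasDerivAt_complexMGF (hg.mem_interior (u := 0) hz)
  have he : laplace g = complexMGF (fun v => -(0 + v)) (densityMeasure g) := by
    ext w
    rw [laplace, complexMGF, integral_densityMeasure hg.measurable hg.nonneg]
    congr 1 with v
    rw [Complex.real_smul, mul_comm]
    push_cast
    ring_nf
  rw [he]
  refine h.congr_deriv ?_
  rw [integral_densityMeasure hg.measurable hg.nonneg, ← integral_neg]
  congr 1 with v
  rw [Complex.real_smul]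
  push_cast
  ring_nf

theorem integrableOn_id_mul (hg : IsLaplaceDensity g) {t : ℝ} (ht : 0 < t) :
    IntegrableOn (fun v : ℝ => Real.exp (-(v * t)) * (v * g v)) (Ioi 0) := by
  refine (hg.integrableOn_pow 0 ht 1).congr (Eventually.of_forall fun v => ?_)
  simp only
  ring_nf

theorem norm_laplace_le (hg : IsLaplaceDensity g) (z : ℂ) :
    ‖laplace g z‖ ≤ realLaplace g z.re := by
  refine (norm_integral_le_integral_norm _).trans (le_of_eq ?_)
  rw [realLaplace]
  congr 1 with v
  rw [norm_mul, Complex.norm_exp, Complex.norm_real, Real.norm_of_nonneg (hg.nonneg v)]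
  simp

theorem realLaplace_nonneg (hg : IsLaplaceDensity g) (t : ℝ) : 0 ≤ realLaplace g t :=
  integral_nonneg fun v => mul_nonneg (Real.exp_pos _).le (hg.nonneg v)

/-- On the support `v ≥ 1` one has `(v - 1)(t - 1) ≥ 0`, that is `-vt ≤ (1 - t) - v`. -/
theorem realLaplace_le (hg : IsLaplaceDensity g) (h1 : ∀ v < 1, g v = 0) {t : ℝ} (ht : 1 ≤ t) :
    realLaplace g t ≤ Real.exp (1 - t) * realLaplace g 1 := by
  rw [realLaplace, realLaplace, ← integral_const_mul]
  refine integral_mono (hg.integrableOn t (by linarith))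
    ((hg.integrableOn 1 one_pos).const_mul _) fun v => ?_
  simp only
  rcases lt_or_ge v 1 with hv | hv
  · simp [h1 v hv]
  · rw [← mul_assoc, ← Real.exp_add]
    refine mul_le_mul_of_nonneg_right (Real.exp_le_exp.2 ?_) (hg.nonneg v)
    nlinarith

theorem tendsto_rpow_mul_realLaplace (hg : IsLaplaceDensity g) (h1 : ∀ v < 1, g v = 0) (s : ℝ) :
    Tendsto (fun t => t ^ s * realLaplace g t) atTop (𝓝 0) := by
  have h := (tendsto_rpow_mul_exp_neg_mul_atTop_nhds_zero s 1 one_pos).const_mul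
    (Real.exp 1 * realLaplace g 1)
  rw [mul_zero] at h
  refine squeeze_zero' ?_ ?_ h
  · filter_upwards [eventually_ge_atTop 0] with t ht
    exact mul_nonneg (Real.rpow_nonneg ht s) (hg.realLaplace_nonneg t)
  · filter_upwards [eventually_ge_atTop 1] with t ht
    calc t ^ s * realLaplace g t ≤ t ^ s * (Real.exp (1 - t) * realLaplace g 1) := by
          gcongr
          exact hg.realLaplace_le h1 ht
      _ = _ := by rw [sub_eq_add_neg, Real.exp_add]; ring_nf

end IsLaplaceDensity

/-! ### The Laplace transform of the delay equation -/

theorem integrableOn_exp_mul_rpow {s t : ℝ} (hs : -1 < s) (ht : 0 < t) :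
    IntegrableOn (fun v : ℝ => Real.exp (-(v * t)) * v ^ s) (Ioi 0) := by
  have h := integrableOn_rpow_mul_exp_neg_mul_rpow (p := 1) hs one_pos ht
  refine h.congr_fun (fun v _ => ?_) measurableSet_Ioi
  simp only [Real.rpow_one]
  ring_nf

theorem isLaplaceDensity_delayLambda {κ : ℝ} (hκ : 1 < κ) {A : ℝ} (hA : 0 ≤ A) :
    IsLaplaceDensity (delayLambda κ A) where
  measurable := (continuous_delayLambda hκ A).measurable
  nonneg := delayLambda_nonneg hκ hA
  integrableOn t ht := by
    refine Integrable.mono' (((integrableOn_exp_mul_rpow (s := κ - 1) (by linarith) ht).add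
      (integrableOn_exp_mul_rpow (s := 2 * κ - 1) (by linarith) ht)).const_mul A) ?_ ?_
    · have := (continuous_delayLambda hκ A).measurable
      exact Measurable.aestronglyMeasurable (by fun_prop)
    · refine (ae_restrict_iff' measurableSet_Ioi).2 (Eventually.of_forall fun v hv => ?_)
      rw [norm_mul, Real.norm_of_nonneg (Real.exp_pos _).le,
        Real.norm_of_nonneg (delayLambda_nonneg hκ hA v)]
      calc Real.exp (-(v * t)) * delayLambda κ A v
          ≤ Real.exp (-(v * t)) * (A * (v ^ (κ - 1) + v ^ (2 * κ - 1))) := by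
            gcongr
            exact delayLambda_le hκ hA hv
        _ = A * (Real.exp (-(v * t)) * v ^ (κ - 1) + Real.exp (-(v * t)) * v ^ (2 * κ - 1)) := by
          ring

theorem integrable_exp_mul_delayLambda {κ : ℝ} (hκ : 1 < κ) {A : ℝ} (hA : 0 ≤ A) {z : ℂ}
    (hz : 0 < z.re) :
    Integrable fun v : ℝ => Complex.exp (-(v * z)) * delayLambda κ A v := by
  refine (integrableOn_iff_integrable_of_support_subset fun v hv => ?_).1
    ((isLaplaceDensity_delayLambda hκ hA).integrableOn_complex hz)
  by_contra h
  exact hv (by simp [delayLambda_of_nonpos hκ A (not_lt.1 h)])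

theorem laplace_delayLambda_eq_integral {κ : ℝ} (hκ : 1 < κ) (A : ℝ) (z : ℂ) :
    laplace (delayLambda κ A) z = ∫ v : ℝ, Complex.exp (-(v * z)) * delayLambda κ A v :=
  setIntegral_eq_integral_of_forall_compl_eq_zero fun v hv => by
    simp [delayLambda_of_nonpos hκ A (not_lt.1 hv)]

/-- As the function vanishes on `v ≤ 0`, both half-line integrals are integrals over `ℝ`, where
translation by `1` costs only the factor `e^{-z}`. -/
theorem integral_exp_mul_delayLambda_sub_one {κ : ℝ} (hκ : 1 < κ) {A : ℝ} (hA : 0 ≤ A) {z : ℂ}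
    (hz : 0 < z.re) :
    IntegrableOn (fun v : ℝ => Complex.exp (-(v * z)) * delayLambda κ A (v - 1)) (Ioi 0) ∧
    ∫ v in Ioi (0 : ℝ), Complex.exp (-(v * z)) * delayLambda κ A (v - 1)
      = Complex.exp (-z) * laplace (delayLambda κ A) z := by
  set F : ℝ → ℂ := fun v => Complex.exp (-(v * z)) * delayLambda κ A v with hF
  have hint : Integrable F := integrable_exp_mul_delayLambda hκ hA hz
  have hshift : (fun v : ℝ => Complex.exp (-(v * z)) * delayLambda κ A (v - 1))
      = fun v => Complex.exp (-z) * F (v - 1) := by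
    ext v
    rw [hF, ← mul_assoc, ← Complex.exp_add]
    push_cast
    ring_nf
  rw [hshift]
  refine ⟨((hint.comp_sub_right 1).const_mul _).integrableOn, ?_⟩
  rw [integral_const_mul, setIntegral_eq_integral_of_forall_compl_eq_zero fun v hv => ?_,
    integral_sub_right_eq_self F 1, laplace_delayLambda_eq_integral hκ]
  have hv1 : v - 1 ≤ 0 := by
    rw [mem_Ioi, not_lt] at hv
    linarith
  simp only [hF, delayLambda_of_nonpos hκ A hv1, Complex.ofReal_zero, mul_zero]

/-- The Laplace transform of the delay differential equation. -/
theorem mul_integral_exp_mul_delayLambda {κ : ℝ} (hκ : 1 < κ) {A : ℝ} (hA : 0 ≤ A) {z : ℂ}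
    (hz : 0 < z.re) :
    z * ∫ v in Ioi (0 : ℝ), Complex.exp (-(v * z)) * ((v * delayLambda κ A v : ℝ) : ℂ)
      = κ * (1 + Complex.exp (-z)) * laplace (delayLambda κ A) z := by
  have hg := isLaplaceDensity_delayLambda hκ hA
  obtain ⟨hi1, he1⟩ := integral_exp_mul_delayLambda_sub_one hκ hA hz
  have hi0 := hg.integrableOn_complex hz
  have hcont := continuous_delayLambda hκ A
  have hi2 : IntegrableOn (fun v : ℝ => Complex.exp (-(v * z)) *
      ((v * delayLambda κ A v : ℝ) : ℂ)) (Ioi 0) := by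
    refine (hg.integrableOn_id_mul hz).mono' ?_ ?_
    · exact Continuous.aestronglyMeasurable (by fun_prop)
    · refine (ae_restrict_iff' measurableSet_Ioi).2 (Eventually.of_forall fun v hv => ?_)
      rw [norm_mul, Complex.norm_exp, Complex.norm_real, Real.norm_of_nonneg
        (mul_nonneg (le_of_lt hv) (hg.nonneg v))]
      simp
  have hderiv : ∀ v ∈ Ioi (0 : ℝ), HasDerivAt
      (fun v : ℝ => Complex.exp (-(v * z)) * ((v * delayLambda κ A v : ℝ) : ℂ))
      (κ * (Complex.exp (-(v * z)) * delayLambda κ A v)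
        + κ * (Complex.exp (-(v * z)) * delayLambda κ A (v - 1))
        - z * (Complex.exp (-(v * z)) * ((v * delayLambda κ A v : ℝ) : ℂ))) v := by
    intro v hv
    have h1 : HasDerivAt (fun v : ℝ => Complex.exp (-(v * z))) (Complex.exp (-(v * z)) * -(1 * z)) v :=
      (((hasDerivAt_id v).ofReal_comp.mul_const z).neg).cexp
    refine (h1.mul (hasDerivAt_mul_delayLambda hκ A hv).ofReal_comp).congr_deriv ?_
    push_cast
    ring
  have hbd : ∀ v ∈ Ioi (1 : ℝ), ‖Complex.exp (-(v * z)) * ((v * delayLambda κ A v : ℝ) : ℂ)‖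
      ≤ A * (v ^ κ * Real.exp (-z.re * v) + v ^ (2 * κ) * Real.exp (-z.re * v)) := by
    intro v hv
    have hv0 : (0 : ℝ) < v := lt_trans one_pos hv
    rw [norm_mul, Complex.norm_exp, Complex.norm_real, Real.norm_of_nonneg
        (mul_nonneg hv0.le (hg.nonneg v))]
    have hre : (-((v : ℂ) * z)).re = -z.re * v := by simp [mul_comm]
    rw [hre]
    calc Real.exp (-z.re * v) * (v * delayLambda κ A v)
        ≤ Real.exp (-z.re * v) * (v * (A * (v ^ (κ - 1) + v ^ (2 * κ - 1)))) := by
          gcongr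
          exact delayLambda_le hκ hA hv0
      _ = _ := by
          rw [Real.rpow_sub_one hv0.ne', Real.rpow_sub_one hv0.ne']
          field_simp
  have hlim : Tendsto (fun v : ℝ => Complex.exp (-(v * z)) * ((v * delayLambda κ A v : ℝ) : ℂ))
      atTop (𝓝 0) := by
    have h := (((tendsto_rpow_mul_exp_neg_mul_atTop_nhds_zero κ z.re hz).add
      (tendsto_rpow_mul_exp_neg_mul_atTop_nhds_zero (2 * κ) z.re hz)).const_mul A)
    rw [add_zero, mul_zero] at h
    refine squeeze_zero_norm' ?_ h
    filter_upwards [Ioi_mem_atTop 1] with v hv using hbd v hv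
  have hi3 : IntegrableOn (fun v : ℝ => κ * (Complex.exp (-(v * z)) * delayLambda κ A v)
      + κ * (Complex.exp (-(v * z)) * delayLambda κ A (v - 1))) (Ioi 0) :=
    (hi0.const_mul (κ : ℂ)).add (hi1.const_mul (κ : ℂ))
  -- The derivative of `e^{-vz} v λ(v)` integrates to `0`: the factor `v` kills the boundary term at
  -- `0`, exponential decay the one at infinity.
  have hparts := integral_Ioi_of_hasDerivAt_of_tendsto (a := (0 : ℝ))
    (Continuous.continuousWithinAt (by fun_prop)) hderiv
    (hi3.sub (hi2.const_mul z)) hlim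
  rw [integral_sub hi3 (hi2.const_mul z),
    integral_add (hi0.const_mul (κ : ℂ)) (hi1.const_mul (κ : ℂ)), integral_const_mul,
    integral_const_mul, integral_const_mul, he1] at hparts
  rw [← laplace] at hparts
  simp only [zero_mul, Complex.ofReal_zero, mul_zero, sub_zero] at hparts
  linear_combination -hparts

/-! ### `Ein` on the right half-plane, and Euler's constant -/

theorem eq_of_hasDerivAt_zero_of_re_pos {f : ℂ → ℂ} (hf : ∀ z : ℂ, 0 < z.re → HasDerivAt f 0 z)
    {z w : ℂ} (hz : 0 < z.re) (hw : 0 < w.re) : f z = f w := by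
  refine IsOpen.is_const_of_fderiv_eq_zero (𝕜 := ℂ) (s := {z : ℂ | 0 < z.re})
    (isOpen_lt continuous_const Complex.continuous_re)
    (convex_halfSpace_re_gt 0).isPreconnected
    (fun x hx => (hf x hx).differentiableAt.differentiableWithinAt) (fun x hx => ?_) hz hw
  have := (hf x hx).hasFDerivAt.fderiv
  rw [this]
  ext
  simp

theorem ne_zero_of_re_pos {z : ℂ} (hz : 0 < z.re) : z ≠ 0 := by
  rintro rfl
  simp at hz

/-- For `0 < s ≤ 1` the integrand agrees with a continuous function built from the divided
difference of `exp` at `0`. -/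
theorem intervalIntegrable_complexEin (z : ℂ) : IntervalIntegrable
    (fun s : ℝ => (1 - Complex.exp (-((s : ℂ) * z))) / ((s : ℂ) * z) * z) volume 0 1 := by
  have hd : Continuous (dslope Complex.exp 0) := by
    rw [← continuousOn_univ]
    exact (continuousOn_dslope univ_mem).2 ⟨Complex.continuous_exp.continuousOn,
      Complex.differentiable_exp.differentiableAt⟩
  have hc : Continuous fun s : ℝ => dslope Complex.exp 0 (-((s : ℂ) * z)) * z :=
    (hd.comp (by fun_prop)).mul continuous_const
  refine (hc.intervalIntegrable 0 1).congr fun s hs => ?_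
  rw [uIoc_of_le zero_le_one] at hs
  rcases eq_or_ne z 0 with rfl | hz
  · simp
  have hs0 : (s : ℂ) ≠ 0 := by exact_mod_cast hs.1.ne'
  rw [dslope_of_ne _ (neg_ne_zero.2 (mul_ne_zero hs0 hz)), slope_def_field]
  simp only [Complex.exp_zero, sub_zero]
  field_simp
  ring

/-- The `w`-derivative of the integrand is `e^{-sw}`, bounded by `1` for `Re w > 0`, and `∫_0^1
e^{-sz} ds = (1 - e^{-z})/z`. -/
theorem hasDerivAt_complexEin {z : ℂ} (hz : 0 < z.re) :
    HasDerivAt complexEin ((1 - Complex.exp (-z)) / z) z := by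
  have hz0 := ne_zero_of_re_pos hz
  have hU : {w : ℂ | 0 < w.re} ∈ 𝓝 z :=
    (isOpen_lt continuous_const Complex.continuous_re).mem_nhds hz
  have h := intervalIntegral.hasDerivAt_integral_of_dominated_loc_of_deriv_le (𝕜 := ℂ)
    (μ := volume) (a := 0) (b := 1) (bound := fun _ => 1)
    (F := fun (w : ℂ) (s : ℝ) => (1 - Complex.exp (-((s : ℂ) * w))) / ((s : ℂ) * w) * w)
    (F' := fun (w : ℂ) (s : ℝ) => Complex.exp (-((s : ℂ) * w))) hU
    (Eventually.of_forall fun w => Measurable.aestronglyMeasurable (by fun_prop))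
    (intervalIntegrable_complexEin z)
    (Continuous.aestronglyMeasurable (by fun_prop))
    (Eventually.of_forall fun s hs w (hw : 0 < w.re) => ?_)
    intervalIntegrable_const
    (Eventually.of_forall fun s hs w (hw : 0 < w.re) => ?_)
  · refine h.2.congr_deriv ?_
    have he : ∀ s : ℝ, Complex.exp (-((s : ℂ) * z)) = Complex.exp (-z * s) := fun s => by
      ring_nf
    simp_rw [he]
    rw [integral_exp_mul_complex (neg_ne_zero.2 hz0)]
    simp only [Complex.ofReal_one, mul_one, Complex.ofReal_zero, mul_zero, Complex.exp_zero]
    field_simp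
    ring
  · rw [uIoc_of_le zero_le_one] at hs
    rw [Complex.norm_exp, Real.exp_le_one_iff]
    have : 0 < s * w.re := mul_pos hs.1 hw
    simp
    linarith
  · rw [uIoc_of_le zero_le_one] at hs
    have hs0 : (s : ℂ) ≠ 0 := by exact_mod_cast hs.1.ne'
    have h1 : HasDerivAt (fun w : ℂ => (1 - Complex.exp (-((s : ℂ) * w))) / s)
        (Complex.exp (-((s : ℂ) * w))) w := by
      have := ((((hasDerivAt_id w).const_mul (s : ℂ)).neg.cexp).const_sub 1).div_const (s : ℂ)
      refine this.congr_deriv ?_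
      simp only [id_eq, mul_one]
      field_simp
      simp
    refine h1.congr_of_eventuallyEq ?_
    filter_upwards [isOpen_ne.mem_nhds (ne_zero_of_re_pos hw)] with x hx
    have : x ≠ 0 := hx
    field_simp

/-- The density of the exponential integral `E₁`, as a Laplace transform. -/
def expIntDensity : ℝ → ℝ := (Ioi 1).indicator fun v => v⁻¹

theorem expIntDensity_nonneg (v : ℝ) : 0 ≤ expIntDensity v :=
  indicator_nonneg (fun w (hw : 1 < w) => inv_nonneg.2 (by linarith)) v

theorem expIntDensity_le_one (v : ℝ) : expIntDensity v ≤ 1 :=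
  indicator_le' (fun w (hw : 1 < w) => inv_le_one_of_one_le₀ hw.le) (fun _ _ => zero_le_one) v

theorem isLaplaceDensity_expIntDensity : IsLaplaceDensity expIntDensity where
  measurable := measurable_inv.indicator measurableSet_Ioi
  nonneg := expIntDensity_nonneg
  integrableOn t ht := by
    have hi : IntegrableOn (fun v : ℝ => Real.exp (-t * v)) (Ioi 0) :=
      integrableOn_exp_mul_Ioi (by linarith) 0
    refine hi.mono' ?_ (Eventually.of_forall fun v => ?_)
    · have : Measurable expIntDensity := measurable_inv.indicator measurableSet_Ioi
      exact Measurable.aestronglyMeasurable (by fun_prop)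
    · rw [norm_mul, Real.norm_of_nonneg (Real.exp_pos _).le,
        Real.norm_of_nonneg (expIntDensity_nonneg v)]
      calc _ ≤ Real.exp (-(v * t)) * 1 := by
            gcongr
            exact expIntDensity_le_one v
        _ = _ := by ring_nf

theorem expIntDensity_eq_zero {v : ℝ} (hv : v ≤ 1) : expIntDensity v = 0 :=
  indicator_of_notMem (fun h => not_lt.2 hv h) _

theorem hasDerivAt_laplace_expIntDensity {z : ℂ} (hz : 0 < z.re) :
    HasDerivAt (laplace expIntDensity) (-(Complex.exp (-z) / z)) z := by
  refine (isLaplaceDensity_expIntDensity.hasDerivAt_laplace hz).congr_deriv ?_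
  congr 1
  have he : (fun v : ℝ => Complex.exp (-(v * z)) * ((v * expIntDensity v : ℝ) : ℂ))
      = (Ioi 1).indicator fun v : ℝ => Complex.exp (-z * v) := by
    ext v
    by_cases hv : v ∈ Ioi (1 : ℝ)
    · have h0 : v ≠ 0 := by rw [mem_Ioi] at hv; linarith
      rw [indicator_of_mem hv, expIntDensity, indicator_of_mem hv, mul_inv_cancel₀ h0]
      simp [mul_comm]
    · rw [indicator_of_notMem hv, expIntDensity, indicator_of_notMem hv]
      simp
  rw [he, setIntegral_indicator measurableSet_Ioi,
    inter_eq_right.2 (Ioi_subset_Ioi zero_le_one), integral_exp_mul_complex_Ioi (by simpa using hz)]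
  simp

/-- `Γ(s) - 1/s = (Γ(1+s) - Γ(1))/s`, a difference quotient tending to `Γ'(1) = -γ`. -/
theorem tendsto_Gamma_sub_inv :
    Tendsto (fun s : ℝ => Real.Gamma s - s⁻¹) (𝓝[>] 0) (𝓝 (-Real.eulerMascheroniConstant)) := by
  have h := Real.hasDerivAt_Gamma_one.tendsto_slope_zero_right
  refine h.congr' ?_
  filter_upwards [self_mem_nhdsWithin] with s (hs : 0 < s)
  rw [add_comm 1 s, Real.Gamma_add_one hs.ne', Real.Gamma_one, smul_eq_mul]
  field_simp

/-- Writing `1/s = ∫_0^1 x^{s-1} dx` removes the singularity at `x = 0` that would obstruct the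
limit `s → 0+`. -/
theorem Gamma_sub_inv_eq {s : ℝ} (hs : 0 < s) : Real.Gamma s - s⁻¹
    = ∫ x in Ioi (0 : ℝ), (Real.exp (-x) - (Iic 1).indicator 1 x) * x ^ (s - 1) := by
  have h1 : (fun x : ℝ => (Iic 1).indicator 1 x * x ^ (s - 1))
      = (Iic 1).indicator fun x : ℝ => x ^ (s - 1) := by
    ext x
    by_cases hx : x ∈ Iic (1 : ℝ)
    · simp [indicator_of_mem hx]
    · simp [indicator_of_notMem hx]
  have h2 : IntegrableOn (fun x : ℝ => x ^ (s - 1)) (Ioi 0 ∩ Iic 1) := by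
    rw [Ioi_inter_Iic, ← intervalIntegrable_iff_integrableOn_Ioc_of_le zero_le_one]
    exact intervalIntegral.intervalIntegrable_rpow' (by linarith)
  have h3 : IntegrableOn (fun x : ℝ => (Iic 1).indicator 1 x * x ^ (s - 1)) (Ioi 0) := by
    rw [h1, IntegrableOn, integrable_indicator_iff measurableSet_Iic, IntegrableOn,
      Measure.restrict_restrict measurableSet_Iic, inter_comm]
    exact h2
  have h4 : ∫ x in Ioi (0 : ℝ), (Iic 1).indicator 1 x * x ^ (s - 1) = s⁻¹ := by
    rw [h1, setIntegral_indicator measurableSet_Iic, Ioi_inter_Iic,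
      ← intervalIntegral.integral_of_le zero_le_one, integral_rpow (Or.inl (by linarith))]
    simp [Real.zero_rpow hs.ne']
  simp_rw [sub_mul]
  rw [integral_sub (Real.GammaIntegral_convergent hs) h3, h4, Real.Gamma_eq_integral hs]

theorem norm_exp_sub_indicator_mul_rpow_le {s x : ℝ} (hs : 0 < s) (hs1 : s ≤ 1) (hx : 0 < x) :
    ‖(Real.exp (-x) - (Iic 1).indicator 1 x) * x ^ (s - 1)‖ ≤ Real.exp 1 * Real.exp (-x) := by
  rw [norm_mul, Real.norm_of_nonneg (Real.rpow_nonneg hx.le _)]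
  by_cases h1 : x ∈ Iic (1 : ℝ)
  · rw [indicator_of_mem h1, Pi.one_apply, norm_sub_rev, Real.norm_of_nonneg
      (by linarith [Real.exp_le_one_iff.2 (by linarith : -x ≤ 0)]), ← Real.exp_add]
    calc (1 - Real.exp (-x)) * x ^ (s - 1) ≤ x * x ^ (s - 1) := by
          gcongr
          linarith [Real.add_one_le_exp (-x)]
      _ = x ^ s := by rw [Real.rpow_sub_one hx.ne']; field_simp
      _ ≤ 1 := Real.rpow_le_one hx.le h1 hs.le
      _ ≤ Real.exp (1 + -x) := Real.one_le_exp (by rw [mem_Iic] at h1; linarith)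
  · rw [indicator_of_notMem h1, sub_zero, Real.norm_of_nonneg (Real.exp_pos _).le, mul_comm]
    rw [mem_Iic, not_le] at h1
    gcongr
    exact (Real.rpow_le_one_of_one_le_of_nonpos h1.le (by linarith)).trans
      (Real.one_le_exp zero_le_one)

/-- Letting `s → 0+` in the formula for `Γ(s) - 1/s` gives `-γ = ∫_0^∞ (e^{-x} - 1_{x ≤ 1}) dx/x`,
which splits at `x = 1` into `E₁(1) - Ein(1)`. -/
theorem realEin_one_sub : realEin 1 - realLaplace expIntDensity 1
    = Real.eulerMascheroniConstant := by
  have hlim : Tendsto (fun s : ℝ => Real.Gamma s - s⁻¹) (𝓝[>] 0)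
      (𝓝 (∫ x in Ioi (0 : ℝ), (Real.exp (-x) - (Iic 1).indicator 1 x) * x⁻¹)) := by
    have h : Tendsto (fun s : ℝ => ∫ x in Ioi (0 : ℝ),
        (Real.exp (-x) - (Iic 1).indicator 1 x) * x ^ (s - 1)) (𝓝[>] 0)
        (𝓝 (∫ x in Ioi (0 : ℝ), (Real.exp (-x) - (Iic 1).indicator 1 x) * x⁻¹)) := by
      refine tendsto_integral_filter_of_dominated_convergence
        (fun x => Real.exp 1 * Real.exp (-x)) ?_ ?_ ?_ ?_
      · have : Measurable ((Iic (1 : ℝ)).indicator (1 : ℝ → ℝ)) :=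
          measurable_one.indicator measurableSet_Iic
        exact Eventually.of_forall fun s => Measurable.aestronglyMeasurable (by fun_prop)
      · filter_upwards [Ioc_mem_nhdsGT one_pos] with s hs
        refine (ae_restrict_iff' measurableSet_Ioi).2 (Eventually.of_forall fun x hx => ?_)
        exact norm_exp_sub_indicator_mul_rpow_le hs.1 hs.2 hx
      · have := (integrableOn_exp_mul_Ioi (a := -1) (by norm_num) 0).const_mul (Real.exp 1)
        simpa using this
      · refine (ae_restrict_iff' measurableSet_Ioi).2 (Eventually.of_forall fun x hx => ?_)
        refine Tendsto.const_mul _ ?_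
        have hc : ContinuousAt (fun s : ℝ => x ^ (s - 1)) 0 :=
          (Real.continuousAt_const_rpow (ne_of_gt hx)).comp (by fun_prop)
        have := hc.tendsto
        rw [zero_sub, Real.rpow_neg_one] at this
        exact this.mono_left nhdsWithin_le_nhds
    refine h.congr' ?_
    filter_upwards [self_mem_nhdsWithin] with s (hs : 0 < s)
    exact (Gamma_sub_inv_eq hs).symm
  have hγ := tendsto_nhds_unique tendsto_Gamma_sub_inv hlim
  have e1 : IntervalIntegrable (fun t : ℝ => (1 - Real.exp (-t)) / t) volume 0 1 := by
    have := (intervalIntegrable_complexEin 1).norm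
    refine this.congr fun t ht => ?_
    rw [uIoc_of_le zero_le_one] at ht
    have h0 : 0 ≤ (1 - Real.exp (-t)) / t :=
      div_nonneg (by linarith [Real.exp_le_one_iff.2 (by linarith [ht.1] : -t ≤ 0)]) ht.1.le
    simp only [mul_one]
    rw [show (1 - Complex.exp (-(t : ℂ))) / t = (((1 - Real.exp (-t)) / t : ℝ) : ℂ) by push_cast; rfl,
      Complex.norm_real, Real.norm_of_nonneg h0]
  have e2 := isLaplaceDensity_expIntDensity.integrableOn 1 one_pos
  have hsplit : ∀ x : ℝ, (Real.exp (-x) - (Iic 1).indicator 1 x) * x⁻¹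
      = Real.exp (-(x * 1)) * expIntDensity x
        - (Iic 1).indicator (fun t : ℝ => (1 - Real.exp (-t)) / t) x := by
    intro x
    by_cases hx : x ≤ 1
    · rw [indicator_of_mem (mem_Iic.2 hx), indicator_of_mem (mem_Iic.2 hx),
        expIntDensity_eq_zero hx, Pi.one_apply, div_eq_mul_inv]
      ring
    · rw [indicator_of_notMem (show x ∉ Iic (1 : ℝ) from hx),
        indicator_of_notMem (show x ∉ Iic (1 : ℝ) from hx), expIntDensity, indicator_of_mem (mem_Ioi.2 (not_le.1 hx))]
      simp
  simp_rw [hsplit] at hγ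
  rw [integral_sub e2, setIntegral_indicator measurableSet_Iic, Ioi_inter_Iic,
    ← intervalIntegral.integral_of_le zero_le_one] at hγ
  · rw [realEin, realLaplace]
    linarith
  · rw [integrable_indicator_iff measurableSet_Iic, IntegrableOn,
      Measure.restrict_restrict measurableSet_Iic, inter_comm, Ioi_inter_Iic]
    exact (intervalIntegrable_iff_integrableOn_Ioc_of_le zero_le_one).1 e1

/-- `Ein z = log z + γ + E₁(z)` on the right half-plane. -/
theorem complexEin_eq {z : ℂ} (hz : 0 < z.re) : complexEin z
    = Complex.log z + Real.eulerMascheroniConstant + laplace expIntDensity z := by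
  -- The difference has derivative `(1 - e^{-w})/w - 1/w + e^{-w}/w = 0`, so its value at `1`
  -- determines it.
  have h := eq_of_hasDerivAt_zero_of_re_pos
    (f := fun z => complexEin z - Complex.log z - laplace expIntDensity z)
    (fun w hw => ?_) hz (w := 1) (by simp)
  · have h1 := complexEin_ofReal 1
    have h2 := laplace_ofReal expIntDensity 1
    rw [Complex.ofReal_one] at h1 h2
    simp only [h1, h2, Complex.log_one] at h
    rw [← realEin_one_sub]
    push_cast
    linear_combination h
  · have hs : w ∈ Complex.slitPlane := Or.inl hw
    refine (((hasDerivAt_complexEin hw).sub (Complex.hasDerivAt_log hs)).sub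
      (hasDerivAt_laplace_expIntDensity hw)).congr_deriv ?_
    have := ne_zero_of_re_pos hw
    field_simp
    ring

/-! ### The closed form of the Laplace transform -/

/-- The part `A v^{κ-1}` contributes exactly `A Γ(κ) t^{-κ}`; the remainder `r` vanishes for `v <
1`, so its transform decays exponentially. -/
theorem tendsto_rpow_mul_realLaplace_delayLambda {κ : ℝ} (hκ : 1 < κ) {A : ℝ} (hA : 0 ≤ A) :
    Tendsto (fun t => t ^ κ * realLaplace (delayLambda κ A) t) atTop (𝓝 (A * Real.Gamma κ)) := by
  have hg := isLaplaceDensity_delayLambda hκ hA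
  set r : ℝ → ℝ := fun v => max v 0 ^ (κ - 1) * (delaySolution κ A v - A) with hr
  have hr_nonneg : ∀ v, 0 ≤ r v := fun v =>
    mul_nonneg (Real.rpow_nonneg (le_max_right v 0) _) (sub_nonneg.2 (le_delaySolution hκ hA v))
  have hr_le : ∀ v, r v ≤ delayLambda κ A v := fun v =>
    mul_le_mul_of_nonneg_left (by linarith) (Real.rpow_nonneg (le_max_right v 0) _)
  have hr_meas : Measurable r := Continuous.measurable
    (((continuous_id.max continuous_const).rpow_const fun _ => Or.inr (by linarith)).mul
      ((continuous_delaySolution hκ A).sub continuous_const))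
  have hrg : IsLaplaceDensity r :=
    { measurable := hr_meas
      nonneg := hr_nonneg
      integrableOn := fun t ht => by
        refine (hg.integrableOn t ht).mono' (Measurable.aestronglyMeasurable (by fun_prop))
          (Eventually.of_forall fun v => ?_)
        rw [norm_mul, Real.norm_of_nonneg (Real.exp_pos _).le, Real.norm_of_nonneg (hr_nonneg v)]
        exact mul_le_mul_of_nonneg_left (hr_le v) (Real.exp_pos _).le }
  have h0 := hrg.tendsto_rpow_mul_realLaplace
    (fun v hv => by simp [hr, delaySolution_of_le_one hκ A hv.le]) κ
  have h1 := h0.const_add (A * Real.Gamma κ)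
  rw [add_zero] at h1
  refine h1.congr' ?_
  filter_upwards [Ioi_mem_atTop 0] with t (ht : 0 < t)
  have hsum : realLaplace (delayLambda κ A) t
      = A * ((1 / t) ^ κ * Real.Gamma κ) + realLaplace r t := by
    rw [← Real.integral_rpow_mul_exp_neg_mul_Ioi (by linarith) ht, realLaplace, realLaplace,
      ← integral_const_mul, ← integral_add]
    · refine setIntegral_congr_fun measurableSet_Ioi fun v (hv : 0 < v) => ?_
      simp only [hr, delayLambda, max_eq_left hv.le]
      rw [mul_comm t v]
      ring
    · refine Integrable.const_mul ?_ A
      refine (integrableOn_exp_mul_rpow (s := κ - 1) (by linarith) ht).congr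
        (Eventually.of_forall fun v => ?_)
      simp only
      rw [mul_comm t v, mul_comm]
    · exact hrg.integrableOn t ht
  have h2 : t ^ κ * (1 / t) ^ κ = 1 := by
    rw [← Real.mul_rpow ht.le (by positivity), mul_one_div_cancel ht.ne', Real.one_rpow]
  rw [hsum]
  linear_combination (-A * Real.Gamma κ) * h2

/-- The initial constant `e^{κγ} / Γ(κ)`. -/
def initialConst (κ : ℝ) : ℝ := Real.exp (κ * Real.eulerMascheroniConstant) / Real.Gamma κ

theorem initialConst_nonneg {κ : ℝ} (hκ : 1 < κ) : 0 ≤ initialConst κ :=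
  div_nonneg (Real.exp_pos _).le (Real.Gamma_nonneg_of_nonneg (by linarith))

theorem hasDerivAt_laplace_delayLambda {κ : ℝ} (hκ : 1 < κ) {A : ℝ} (hA : 0 ≤ A) {z : ℂ}
    (hz : 0 < z.re) : HasDerivAt (laplace (delayLambda κ A))
      (-(κ * (1 + Complex.exp (-z)) * laplace (delayLambda κ A) z / z)) z := by
  refine ((isLaplaceDensity_delayLambda hκ hA).hasDerivAt_laplace hz).congr_deriv ?_
  rw [← mul_integral_exp_mul_delayLambda hκ hA hz, mul_div_cancel_left₀ _ (ne_zero_of_re_pos hz)]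

/-- The exponential is the reciprocal of `z^{-2κ} e^{κ Ein z}`, so the logarithmic derivatives of
the two factors cancel. -/
theorem laplace_delayLambda_mul_eq {κ : ℝ} (hκ : 1 < κ) {A : ℝ} (hA : 0 ≤ A) {z w : ℂ}
    (hz : 0 < z.re) (hw : 0 < w.re) :
    laplace (delayLambda κ A) z * Complex.exp (2 * κ * Complex.log z - κ * complexEin z)
      = laplace (delayLambda κ A) w * Complex.exp (2 * κ * Complex.log w - κ * complexEin w) := by
  refine eq_of_hasDerivAt_zero_of_re_pos (f := fun z => laplace (delayLambda κ A) z *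
    Complex.exp (2 * κ * Complex.log z - κ * complexEin z)) (fun x hx => ?_) hz hw
  have hs : x ∈ Complex.slitPlane := Or.inl hx
  refine ((hasDerivAt_laplace_delayLambda hκ hA hx).mul
    (((Complex.hasDerivAt_log hs).const_mul (2 * (κ : ℂ))).sub
      ((hasDerivAt_complexEin hx).const_mul (κ : ℂ))).cexp).congr_deriv ?_
  have := ne_zero_of_re_pos hx
  simp only [Pi.sub_apply]
  field_simp
  ring

theorem laplace_delayLambda {κ : ℝ} (hκ : 1 < κ) {z : ℂ} (hz : 0 < z.re) :
    laplace (delayLambda κ (initialConst κ)) z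
      = z ^ (-2 * (κ : ℂ)) * Complex.exp (κ * complexEin z) := by
  have hA := initialConst_nonneg hκ
  set L := delayLambda κ (initialConst κ) with hL
  set C := laplace L z * Complex.exp (2 * κ * Complex.log z - κ * complexEin z) with hC
  have hΓ : initialConst κ * Real.Gamma κ = Real.exp (κ * Real.eulerMascheroniConstant) :=
    div_mul_cancel₀ _ (Real.Gamma_pos_of_pos (by linarith)).ne'
  have hC1 : C = 1 := by
    have hleft : Tendsto (fun t : ℝ => ((t ^ κ * realLaplace L t : ℝ) : ℂ)) atTop
        (𝓝 (Complex.exp (κ * Real.eulerMascheroniConstant))) := by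
      have := (Complex.continuous_ofReal.tendsto _).comp
        (tendsto_rpow_mul_realLaplace_delayLambda hκ hA)
      rw [hΓ] at this
      push_cast at this
      simpa [Function.comp_def] using this
    have hE : Tendsto (fun t : ℝ => realLaplace expIntDensity t) atTop (𝓝 0) := by
      simpa using isLaplaceDensity_expIntDensity.tendsto_rpow_mul_realLaplace
        (fun v hv => expIntDensity_eq_zero hv.le) 0
    -- On the real axis `C e^{κ(γ + E₁(t))}` equals `t^κ L(t)`: of `t^{2κ} e^{-κ Ein t}` only `t^κ
    -- e^{-κ(γ + E₁(t))}` survives.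
    have hright : Tendsto (fun t : ℝ => C * Complex.exp (κ * (Real.eulerMascheroniConstant
        + ((realLaplace expIntDensity t : ℝ) : ℂ)))) atTop
        (𝓝 (C * Complex.exp (κ * Real.eulerMascheroniConstant))) := by
      have hc : Continuous fun x : ℝ => C * Complex.exp (κ * (Real.eulerMascheroniConstant + (x : ℂ))) := by
        fun_prop
      have := (hc.tendsto 0).comp hE
      simpa [Function.comp_def] using this
    have heq : Complex.exp (κ * Real.eulerMascheroniConstant)
        = C * Complex.exp (κ * Real.eulerMascheroniConstant) := by
      refine tendsto_nhds_unique hleft (hright.congr' ?_)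
      filter_upwards [Ioi_mem_atTop 0] with t (ht : 0 < t)
      have htre : 0 < (t : ℂ).re := by simpa using ht
      rw [hC, laplace_delayLambda_mul_eq hκ hA hz htre, complexEin_eq htre,
        laplace_ofReal, laplace_ofReal, mul_assoc, ← Complex.exp_add, Real.rpow_def_of_pos ht]
      push_cast
      rw [Complex.ofReal_log ht.le, mul_comm (Complex.exp _)]
      congr 2
      ring
    exact (mul_right_cancel₀ (Complex.exp_ne_zero _) (heq.symm.trans (one_mul _).symm))
  rw [Complex.cpow_def_of_ne_zero (ne_zero_of_re_pos hz), ← Complex.exp_add]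
  have h1 : laplace L z = C * Complex.exp (-(2 * κ * Complex.log z - κ * complexEin z)) := by
    rw [hC, mul_assoc, ← Complex.exp_add, add_neg_cancel, Complex.exp_zero, mul_one]
  rw [h1, hC1, one_mul]
  congr 1
  ring

/-! ### Fourier inversion on vertical lines -/

theorem inversionIntegrand_eq {κ : ℝ} (hκ : 1 < κ) (v : ℝ) {z : ℂ} (hz : 0 < z.re) :
    inversionIntegrand κ v z
      = Complex.exp (v * z) * laplace (delayLambda κ (initialConst κ)) z := by
  rw [inversionIntegrand, laplace_delayLambda hκ hz, mul_assoc]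

/-- The `κ log z` inside `κ Ein z` cancels half of `z^{-2κ}`, and `E₁` is bounded on each vertical
line. -/
theorem norm_laplace_delayLambda_le {κ : ℝ} (hκ : 1 < κ) {z : ℂ} (hz : 0 < z.re) :
    ‖laplace (delayLambda κ (initialConst κ)) z‖ ≤ ‖z‖ ^ (-κ) *
      Real.exp (κ * (Real.eulerMascheroniConstant + realLaplace expIntDensity z.re)) := by
  have hz0 := ne_zero_of_re_pos hz
  rw [laplace_delayLambda hκ hz, Complex.cpow_def_of_ne_zero hz0, ← Complex.exp_add,
    Complex.norm_exp, complexEin_eq hz, Real.rpow_def_of_pos (norm_pos_iff.2 hz0), ← Real.exp_add]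
  have h1 : (laplace expIntDensity z).re ≤ realLaplace expIntDensity z.re :=
    (Complex.re_le_norm _).trans (isLaplaceDensity_expIntDensity.norm_laplace_le z)
  refine Real.exp_le_exp.2 ?_
  have h2 : (Complex.log z * (-2 * κ) + κ * (Complex.log z + Real.eulerMascheroniConstant
      + laplace expIntDensity z)).re = Real.log ‖z‖ * (-κ)
        + κ * (Real.eulerMascheroniConstant + (laplace expIntDensity z).re) := by
    simp [Complex.log_re]
    ring
  rw [h2]
  gcongr

theorem continuous_laplace_vertical {κ : ℝ} (hκ : 1 < κ) {c : ℝ} (hc : 0 < c) :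
    Continuous fun y : ℝ => laplace (delayLambda κ (initialConst κ)) (verticalPoint c y) := by
  rw [continuous_iff_continuousAt]
  intro y
  have hre : 0 < (verticalPoint c y).re := by simpa [verticalPoint] using hc
  refine ContinuousAt.comp (g := laplace _) (f := verticalPoint c)
    (hasDerivAt_laplace_delayLambda hκ (initialConst_nonneg hκ) hre).continuousAt ?_
  unfold verticalPoint
  fun_prop

theorem integrable_laplace_vertical {κ : ℝ} (hκ : 1 < κ) {c : ℝ} (hc : 0 < c) :
    Integrable fun y : ℝ => laplace (delayLambda κ (initialConst κ)) (verticalPoint c y) := by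
  set m := min c 1 with hm
  have hm0 : 0 < m := lt_min hc one_pos
  have hi := integrable_rpow_neg_one_add_norm_sq (E := ℝ) (μ := volume) (r := κ) (by simpa using hκ)
  refine (hi.const_mul (m ^ (-κ) * Real.exp (κ * (Real.eulerMascheroniConstant
    + realLaplace expIntDensity c)))).mono' (continuous_laplace_vertical hκ hc).aestronglyMeasurable
    (Eventually.of_forall fun y => ?_)
  have hre : (verticalPoint c y).re = c := by simp [verticalPoint]
  have him : (verticalPoint c y).im = y := by simp [verticalPoint]
  refine (norm_laplace_delayLambda_le hκ (hre.symm ▸ hc)).trans ?_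
  rw [hre, mul_right_comm]
  refine mul_le_mul_of_nonneg_right ?_ (Real.exp_pos _).le
  -- Since `m ≤ c` and `m ≤ 1`, `m² (1 + y²) ≤ c² + y²`.
  have hb : m * (1 + ‖y‖ ^ 2) ^ (1 / 2 : ℝ) ≤ ‖verticalPoint c y‖ := by
    rw [← Real.sqrt_eq_rpow, Complex.norm_def, Complex.normSq_apply, hre, him]
    refine Real.le_sqrt_of_sq_le ?_
    rw [mul_pow, Real.sq_sqrt (by positivity), Real.norm_eq_abs, sq_abs]
    have h1 : m ≤ c := min_le_left _ _
    have h2 : m ≤ 1 := min_le_right _ _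
    nlinarith [mul_le_mul h1 h1 hm0.le hc.le, mul_le_mul h2 h2 hm0.le zero_le_one, sq_nonneg y]
  calc ‖verticalPoint c y‖ ^ (-κ) ≤ (m * (1 + ‖y‖ ^ 2) ^ (1 / 2 : ℝ)) ^ (-κ) :=
        Real.rpow_le_rpow_of_nonpos (by positivity) hb (by linarith)
    _ = m ^ (-κ) * (1 + ‖y‖ ^ 2) ^ (-κ / 2) := by
        rw [Real.mul_rpow hm0.le (by positivity), ← Real.rpow_mul (by positivity)]
        congr 2
        ring

-- `w ↦ L(c + 2πiw)` is the Fourier transform of `e^{-cx} λ(x)`. This function is continuous and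
-- integrable with integrable transform, so inversion holds at every point.
open FourierTransform in
theorem integral_exp_mul_laplace_vertical {κ : ℝ} (hκ : 1 < κ) {c : ℝ} (hc : 0 < c) (v : ℝ) :
    ∫ y : ℝ, Complex.exp (v * verticalPoint c y)
        * laplace (delayLambda κ (initialConst κ)) (verticalPoint c y)
      = 2 * Real.pi * delayLambda κ (initialConst κ) v := by
  have hA := initialConst_nonneg hκ
  set L := delayLambda κ (initialConst κ) with hL
  set h : ℝ → ℂ := fun x => Complex.exp (-(x * c)) * L x with hh
  have hcont : Continuous h := by
    have := continuous_delayLambda hκ (initialConst κ)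
    fun_prop
  have hint : Integrable h := integrable_exp_mul_delayLambda hκ hA (z := c) (by simpa using hc)
  have hF : 𝓕 h = fun w : ℝ => laplace L (verticalPoint c (2 * Real.pi * w)) := by
    ext w
    rw [Real.fourier_real_eq_integral_exp_smul, laplace_delayLambda_eq_integral hκ]
    congr 1 with x
    rw [smul_eq_mul, hh, hL, ← mul_assoc, ← Complex.exp_add, verticalPoint]
    push_cast
    ring_nf
  have hpi : (2 * Real.pi) ≠ 0 := by positivity
  have hFint : Integrable (𝓕 h) := by
    rw [hF]
    exact (integrable_laplace_vertical hκ hc).comp_mul_left' hpi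
  have hinv := congrFun (hcont.fourierInv_fourier_eq hint hFint) v
  rw [hF, Real.fourierInv_eq'] at hinv
  have hsub := Measure.integral_comp_mul_left (fun y : ℝ => Complex.exp (v * verticalPoint c y)
        * laplace L (verticalPoint c y)) (2 * Real.pi)
  have h1 : ∫ w : ℝ, Complex.exp (v * verticalPoint c (2 * Real.pi * w))
        * laplace L (verticalPoint c (2 * Real.pi * w)) = Complex.exp (v * c) * h v := by
    rw [← hinv, ← integral_const_mul]
    congr 1 with w
    rw [smul_eq_mul, ← mul_assoc, ← Complex.exp_add]
    congr 2
    simp [verticalPoint]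
    ring
  rw [h1, hh, ← mul_assoc, ← Complex.exp_add, add_neg_cancel, Complex.exp_zero, one_mul,
    abs_of_pos (by positivity), Complex.real_smul] at hsub
  rw [hsub]
  push_cast
  have : (Real.pi : ℂ) ≠ 0 := by exact_mod_cast Real.pi_ne_zero
  field_simp

/-- Reality and independence of `c` come for free, the right-hand side being a real number that does
not involve `c`. -/
theorem inversionIntegral_eq {κ : ℝ} (hκ : 1 < κ) {c : ℝ} (hc : 0 < c) (v : ℝ) :
    Integrable (fun y : ℝ => inversionIntegrand κ v (verticalPoint c y)) ∧
      inversionIntegral κ c v = delayLambda κ (initialConst κ) v := by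
  have hre : ∀ y, 0 < (verticalPoint c y).re := fun y => by simpa [verticalPoint] using hc
  have he : (fun y : ℝ => inversionIntegrand κ v (verticalPoint c y))
      = fun y : ℝ => Complex.exp (v * verticalPoint c y)
        * laplace (delayLambda κ (initialConst κ)) (verticalPoint c y) :=
    funext fun y => inversionIntegrand_eq hκ v (hre y)
  constructor
  · rw [he]
    refine (integrable_laplace_vertical hκ hc).bdd_mul (c := Real.exp (v * c)) ?_ ?_
    · unfold verticalPoint
      exact Continuous.aestronglyMeasurable (by fun_prop)
    · refine Eventually.of_forall fun y => ?_
      rw [Complex.norm_exp]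
      simp [verticalPoint]
  · rw [inversionIntegral, integral_mul_const, he, integral_exp_mul_laplace_vertical hκ hc]
    have : (Real.pi : ℂ) ≠ 0 := by exact_mod_cast Real.pi_ne_zero
    have := Complex.I_ne_zero
    field_simp

theorem sieveLambda_eq {κ : ℝ} (hκ : 1 < κ) :
    sieveLambda κ = delayLambda κ (initialConst κ) := by
  ext v
  rw [sieveLambda, (inversionIntegral_eq hκ one_pos v).2, Complex.ofReal_re]

/-! ### Derivatives of `f` -/

theorem realLaplace_delayLambda {κ : ℝ} (hκ : 1 < κ) {t : ℝ} (ht : 0 < t) :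
    realLaplace (delayLambda κ (initialConst κ)) t
      = t ^ (-2 * κ) * Real.exp (κ * realEin t) := by
  have h := laplace_delayLambda hκ (z := (t : ℂ)) (by simpa using ht)
  rw [laplace_ofReal, complexEin_ofReal] at h
  have h2 : ((t ^ (-2 * κ) : ℝ) : ℂ) = (t : ℂ) ^ (-2 * (κ : ℂ)) := by
    rw [Complex.ofReal_cpow ht.le]
    push_cast
    rfl
  rw [← h2] at h
  exact_mod_cast h

theorem sieveIntegrand_eq_mgf {κ : ℝ} (hκ : 1 < κ) (u : ℝ) {t : ℝ} (ht : 0 < t) :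
    sieveIntegrand κ u t
      = mgf (fun v => -(u + v)) (densityMeasure (delayLambda κ (initialConst κ))) t := by
  rw [(isLaplaceDensity_delayLambda hκ (initialConst_nonneg hκ)).mgf_eq,
    realLaplace_delayLambda hκ ht, sieveIntegrand]
  ring

theorem contDiffOn_sieveIntegrand {κ : ℝ} (hκ : 1 < κ) (u : ℝ) :
    ContDiffOn ℝ (⊤ : ℕ∞) (sieveIntegrand κ u) (Ioi 0) := by
  have hg := isLaplaceDensity_delayLambda hκ (initialConst_nonneg hκ)
  have h : ContDiffOn ℝ (⊤ : ℕ∞) (mgf (fun v => -(u + v))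
      (densityMeasure (delayLambda κ (initialConst κ)))) (Ioi 0) := fun t ht =>
    (analyticAt_mgf (hg.mem_interior ht)).contDiffAt.contDiffWithinAt
  exact h.congr fun t ht => sieveIntegrand_eq_mgf hκ u ht

theorem iteratedDeriv_sieveIntegrand {κ : ℝ} (hκ : 1 < κ) (u : ℝ) {t : ℝ} (ht : 0 < t) (n : ℕ) :
    iteratedDeriv n (sieveIntegrand κ u) t = (-1) ^ n * ∫ v in Ioi 0,
      (u + v) ^ n * Real.exp (-(u + v) * t) * delayLambda κ (initialConst κ) v := by
  rw [← (isLaplaceDensity_delayLambda hκ (initialConst_nonneg hκ)).iteratedDeriv_mgf_eq u ht n]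
  -- The two functions are known to agree only for positive arguments, which suffices near `t`.
  refine Filter.EventuallyEq.iteratedDeriv_eq n ?_
  filter_upwards [Ioi_mem_nhds ht] with s hs using sieveIntegrand_eq_mgf hκ u hs

theorem iteratedDeriv_four_nonneg {κ : ℝ} (hκ : 1 < κ) (u : ℝ) {t : ℝ} (ht : 0 < t) :
    0 ≤ iteratedDeriv 4 (sieveIntegrand κ u) t := by
  rw [iteratedDeriv_sieveIntegrand hκ u ht, Even.neg_one_pow (by decide), one_mul]
  refine integral_nonneg fun v => ?_
  have := delayLambda_nonneg hκ (initialConst_nonneg hκ) v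
  positivity

/-- Monotonicity is read off the integrands, `e^{-(u+v)t}` decreasing in `t` because `u + v > 0`;
the fifth derivative is not needed. -/
theorem antitoneOn_iteratedDeriv_four {κ : ℝ} (hκ : 1 < κ) {u : ℝ} (hu : 0 < u) :
    AntitoneOn (iteratedDeriv 4 (sieveIntegrand κ u)) (Ioi 0) := by
  intro s (hs : 0 < s) t (ht : 0 < t) hst
  have hA := initialConst_nonneg hκ
  have hg := isLaplaceDensity_delayLambda hκ hA
  rw [iteratedDeriv_sieveIntegrand hκ u ht, iteratedDeriv_sieveIntegrand hκ u hs,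
    Even.neg_one_pow (by decide), one_mul, one_mul]
  refine setIntegral_mono_on (hg.integrableOn_pow u ht 4) (hg.integrableOn_pow u hs 4)
    measurableSet_Ioi fun v (hv : 0 < v) => ?_
  refine mul_le_mul_of_nonneg_right (mul_le_mul_of_nonneg_left ?_ (by positivity))
    (delayLambda_nonneg hκ hA v)
  refine Real.exp_le_exp.2 ?_
  nlinarith

end

theorem mainTheorem8 (κ : ℝ) (hκ : 1 < κ) :
    -- the line integral converges absolutely, is real, and is independent of `c > 0`
    (∀ c : ℝ, 0 < c → ∀ v : ℝ,
      MeasureTheory.Integrable (fun y : ℝ => inversionIntegrand κ v (verticalPoint c y)) ∧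
      inversionIntegral κ c v = (sieveLambda κ v : ℂ)) ∧
    Continuous (sieveLambda κ) ∧
    (∀ v : ℝ, v ≤ 0 → sieveLambda κ v = 0) ∧
    -- the delay differential equation and its boundary condition
    (∀ v : ℝ, 0 < v →
      HasDerivAt (fun w : ℝ => w ^ (1 - κ) * sieveLambda κ w)
        (κ * v ^ (-κ) * sieveLambda κ (v - 1)) v) ∧
    (∀ v : ℝ, 0 ≤ v → v ≤ 1 →
      sieveLambda κ v =
        Real.exp (κ * Real.eulerMascheroniConstant) / Real.Gamma κ * v ^ (κ - 1)) ∧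
    (∀ v : ℝ, 0 ≤ sieveLambda κ v) ∧
    -- the Laplace transform of `λ_κ`
    (∀ t : ℝ, 0 < t →
      MeasureTheory.IntegrableOn (fun v : ℝ => Real.exp (-v * t) * sieveLambda κ v) (Set.Ioi 0) ∧
      ∫ v in Set.Ioi (0 : ℝ), Real.exp (-v * t) * sieveLambda κ v =
        t ^ (-2 * κ) * Real.exp (κ * realEin t)) ∧
    ∀ u : ℝ, 0 < u →
      ContDiffOn ℝ (⊤ : ℕ∞) (sieveIntegrand κ u) (Set.Ioi 0) ∧
      -- integral representations of the fourth and fifth derivatives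
      (∀ t : ℝ, 0 < t →
        MeasureTheory.IntegrableOn
          (fun v : ℝ => (u + v) ^ 4 * Real.exp (-(u + v) * t) * sieveLambda κ v) (Set.Ioi 0) ∧
        iteratedDeriv 4 (sieveIntegrand κ u) t =
          ∫ v in Set.Ioi (0 : ℝ), (u + v) ^ 4 * Real.exp (-(u + v) * t) * sieveLambda κ v) ∧
      (∀ t : ℝ, 0 < t →
        MeasureTheory.IntegrableOn
          (fun v : ℝ => (u + v) ^ 5 * Real.exp (-(u + v) * t) * sieveLambda κ v) (Set.Ioi 0) ∧
        iteratedDeriv 5 (sieveIntegrand κ u) t =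
          -∫ v in Set.Ioi (0 : ℝ), (u + v) ^ 5 * Real.exp (-(u + v) * t) * sieveLambda κ v) ∧
      -- `f⁗` is nonnegative and nonincreasing, so its supremum is attained at the left end
      (∀ t : ℝ, 0 < t → 0 ≤ iteratedDeriv 4 (sieveIntegrand κ u) t) ∧
      AntitoneOn (iteratedDeriv 4 (sieveIntegrand κ u)) (Set.Ioi 0) ∧
      (∀ a b : ℝ, 0 < a → a < b →
        IsLUB ((fun t : ℝ => |iteratedDeriv 4 (sieveIntegrand κ u) t|) '' Set.Icc a b)
          (iteratedDeriv 4 (sieveIntegrand κ u) a)) := by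
  have hA := initialConst_nonneg hκ
  have hg := isLaplaceDensity_delayLambda hκ hA
  rw [sieveLambda_eq hκ]
  refine ⟨fun c hc v => inversionIntegral_eq hκ hc v, continuous_delayLambda hκ _,
    fun v hv => delayLambda_of_nonpos hκ _ hv,
    fun v hv => hasDerivAt_rpow_mul_delayLambda hκ _ hv,
    fun v h0 h1 => delayLambda_of_le_one hκ _ h0 h1, delayLambda_nonneg hκ hA, ?_, ?_⟩
  · intro t ht
    simp_rw [show ∀ v : ℝ, -v * t = -(v * t) from fun v => neg_mul v t]
    exact ⟨hg.integrableOn t ht, realLaplace_delayLambda hκ ht⟩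
  · intro u hu
    refine ⟨contDiffOn_sieveIntegrand hκ u, fun t ht => ⟨hg.integrableOn_pow u ht 4, ?_⟩,
      fun t ht => ⟨hg.integrableOn_pow u ht 5, ?_⟩, fun t ht => iteratedDeriv_four_nonneg hκ u ht,
      antitoneOn_iteratedDeriv_four hκ hu, fun a b ha hab => IsGreatest.isLUB ⟨?_, ?_⟩⟩
    · rw [iteratedDeriv_sieveIntegrand hκ u ht, Even.neg_one_pow (by decide), one_mul]
    · rw [iteratedDeriv_sieveIntegrand hκ u ht, Odd.neg_one_pow (by decide), neg_one_mul]
    · exact ⟨a, ⟨le_rfl, hab.le⟩, abs_of_nonneg (iteratedDeriv_four_nonneg hκ u ha)⟩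
    · rintro _ ⟨t, ht, rfl⟩
      have ht0 : 0 < t := ha.trans_le ht.1
      simp only
      rw [abs_of_nonneg (iteratedDeriv_four_nonneg hκ u ht0)]
      exact antitoneOn_iteratedDeriv_four hκ hu ha ht0 ht.1
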